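/- For a finite simple graph $G$ with vertex set $V$, let $Z_G$ be the affine scheme over $\mathbb{Z}$ of nondegenerate symmetric matrices $M=(M_{ij})_{i,j\in V}$ such that $M_{ij}=0$ whenever there is an edge of $G$ joining $i$ and $j$; that is, $Z_G=\operatorname{Spec}\,(\mathbb{Z}[y_{ij} : i,j\in V]/J_G)_D$, where $J_G$ is the ideal generated by all $y_{ij}-y_{ji}$ and by the $y_{ij}$ with $\{i,j\}$ an edge of $G$, and $D=\det(y_{ij})$ is inverted. A scheme $X$ of finite type over $\mathbb{Z}$ is called polynomially countable, written $[X]\in\mathbb{Z}[q]$, if there is a polynomial $P\in\mathbb{Z}[q]$ such that $\#X(\mathbb{F}_q)=P(q)$ for every prime power $q$. Corollary. For every finite forest $F$ (a finite simple graph with no cycles), the scheme $Z_F$ is polynomially countable, i.e. $[Z_F]\in\mathbb{Z}[q]$. -/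

import Mathlib

open AlgebraicGeometry CategoryTheory

universe u

/-- The ideal of `ℤ[y_{ij}]` generated by the `y_{ij} - y_{ji}` and by the `y_{ij}` for which
`i` and `j` are joined by an edge of `G`. -/
noncomputable def zIdeal {V : Type u} (G : SimpleGraph V) : Ideal (MvPolynomial (V × V) ℤ) :=
  Ideal.span
    ({p | ∃ i j : V, p = MvPolynomial.X (i, j) - MvPolynomial.X (j, i)} ∪
      {p | ∃ i j : V, G.Adj i j ∧ p = MvPolynomial.X (i, j)})

/-- The determinant of the generic matrix `(y_{ij})`. -/
noncomputable def genericDet (V : Type u) [Fintype V] [DecidableEq V] :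
    MvPolynomial (V × V) ℤ :=
  Matrix.det (Matrix.of fun i j : V => MvPolynomial.X (i, j))

/-- The coordinate ring of `Z_G`: the quotient of `ℤ[y_{ij}]` by `zIdeal G`, localized at the
determinant. -/
abbrev ZRing {V : Type u} [Fintype V] [DecidableEq V] (G : SimpleGraph V) : Type u :=
  Localization.Away (Ideal.Quotient.mk (zIdeal G) (genericDet V))

/-- The scheme `Z_G` over `ℤ` of nondegenerate symmetric matrices `M`, indexed by the vertices
of `G`, with `M_{ij} = 0` whenever there is an edge from `i` to `j`. -/
noncomputable def ZScheme {V : Type u} [Fintype V] [DecidableEq V] (G : SimpleGraph V) :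
    Scheme.{u} :=
  Spec (CommRingCat.of (ZRing G))

/-- A scheme `X` is polynomially countable if there is one polynomial `P ∈ ℤ[q]` such that, for
every finite field `K`, the set `X(K)` is finite with `P(#K)` elements. (Morphisms of schemes are
automatically morphisms over `ℤ`.) -/
def PolynomiallyCountable (X : Scheme.{u}) : Prop :=
  ∃ P : Polynomial ℤ, ∀ (K : Type u) [Field K] [Finite K],
    Finite (Spec (CommRingCat.of K) ⟶ X) ∧
      (Nat.card (Spec (CommRingCat.of K) ⟶ X) : ℤ) = P.eval (Nat.card K : ℤ)

/-!
The points of `Z_F` over a finite field with `q` elements are the symmetric matrices of full rank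
supported on the non-edges of `F`; more generally we sum an arbitrary function of the rank over
such matrices supported on a set `S` of vertices, by recursion on `S`.

Let `v ∈ S` have at most one neighbour `u` in `S`. A matrix on `S` arises from a matrix `A` on
`S \ {v}` by bordering with a vector `b`, subject only to `b u = 0`, and a diagonal entry `c`. If
`b` is not in the range of `A`, the rank grows by `2`. If `b = A x`, it grows by `0` or `1`,
according to whether `c = x ⬝ᵥ A x`. Hence only the number of admissible `b` in the range of `A`
matters. With `r = rank A`, it is `q ^ r` if row `u` of `A` vanishes or there is no `u`, and
`q ^ (r - 1)` otherwise. Since the matrices whose row `u` vanishes are those on `S \ {v, u}`, the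
sum over `S` reduces to sums over `S \ {v}` and `S \ {v, u}`, with weights polynomial in `q`.
-/

open Matrix Polynomial

section CoordSubspace

variable {ι R : Type*} [CommSemiring R]

/-- The coordinate subspace `R ^ s` of `R ^ ι`: the vectors that vanish outside `s`. -/
def coordSubspace (R : Type*) [CommSemiring R] (s : Set ι) : Submodule R (ι → R) :=
  ⨅ i ∈ sᶜ, LinearMap.ker (LinearMap.proj i)

theorem mem_coordSubspace {s : Set ι} {b : ι → R} : b ∈ coordSubspace R s ↔ ∀ i ∉ s, b i = 0 := by
  simp [coordSubspace]

theorem finrank_coordSubspace [Finite ι] [StrongRankCondition R] (s : Set ι) :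
    Module.finrank R (coordSubspace R s) = s.ncard := by
  classical
  have := Fintype.ofFinite s
  have e := LinearMap.iInfKerProjEquiv R (fun _ : ι => R)
    (disjoint_compl_right (a := s)) (Set.union_compl_self s).ge
  rw [coordSubspace, e.finrank_eq, Module.finrank_fintype_fun_eq_card, ← Nat.card_eq_fintype_card,
    Nat.card_coe_set_eq]

end CoordSubspace

section Rank

theorem rank_eq_card_iff_isUnit_det {n K : Type*} [Fintype n] [DecidableEq n] [Field K]
    {A : Matrix n n K} : A.rank = Fintype.card n ↔ IsUnit A.det := by
  rw [← isUnit_iff_isUnit_det]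
  refine ⟨fun h => mulVec_surjective_iff_isUnit.1 ?_, rank_of_isUnit A⟩
  exact LinearMap.range_eq_top.1 <| Submodule.eq_top_of_finrank_eq <|
    h.trans (Module.finrank_fintype_fun_eq_card K).symm

theorem mulVec_dotProduct_of_isSymm {n R : Type*} [Fintype n] [CommSemiring R] {A : Matrix n n R}
    (hA : A.IsSymm) (x y : n → R) : A *ᵥ x ⬝ᵥ y = x ⬝ᵥ A *ᵥ y := by
  rw [dotProduct_mulVec, ← mulVec_transpose, hA.eq]

theorem apply_eq_zero_of_mem_range_mulVecLin {m n R : Type*} [Fintype n] [CommSemiring R]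
    {A : Matrix m n R} {i : m} (hi : A.row i = 0) {b : m → R} (hb : b ∈ A.mulVecLin.range) :
    b i = 0 := by
  obtain ⟨y, rfl⟩ := hb
  exact (congrArg (· ⬝ᵥ y) hi).trans (zero_dotProduct y)

/-- The range of a symmetric matrix is the orthogonal complement of its kernel. -/
theorem exists_mulVec_eq_zero_and_dotProduct_eq_one {n K : Type*} [Fintype n] [Field K]
    {A : Matrix n n K} (hA : A.IsSymm) {b : n → K} (hb : b ∉ A.mulVecLin.range) :
    ∃ z, A *ᵥ z = 0 ∧ b ⬝ᵥ z = 1 := by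
  classical
  obtain ⟨f, hfb, hf⟩ := Submodule.exists_le_ker_of_notMem hb
  obtain ⟨z, rfl⟩ := (dotProductEquiv K n).surjective f
  rw [dotProductEquiv_apply_apply, dotProduct_comm] at hfb
  have hAz : A *ᵥ z = 0 := dotProduct_eq_zero _ fun y => by
    rw [mulVec_dotProduct_of_isSymm hA]
    exact hf ⟨y, rfl⟩
  refine ⟨(b ⬝ᵥ z)⁻¹ • z, by rw [mulVec_smul, hAz, smul_zero], ?_⟩
  rw [dotProduct_smul, smul_eq_mul, inv_mul_cancel₀ hfb]

theorem finrank_range_mulVecLin_inf_ker_proj {m n K : Type*} [Finite m] [Fintype n] [Field K]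
    {A : Matrix m n K} {i : m} (hi : A.row i ≠ 0) :
    Module.finrank K ↥(A.mulVecLin.range ⊓ LinearMap.ker (LinearMap.proj i)) = A.rank - 1 := by
  classical
  let f : Module.Dual K A.mulVecLin.range := (LinearMap.proj i).domRestrict _
  have hf : f ≠ 0 := fun h => hi <| funext fun j => by
    simpa [f] using LinearMap.congr_fun h ⟨A *ᵥ Pi.single j 1, LinearMap.mem_range_self _ _⟩
  have hker : Module.finrank K (LinearMap.ker f) + 1 = A.rank :=
    Module.Dual.finrank_ker_add_one_of_ne_zero hf
  rw [← hker, Nat.add_sub_cancel, ← Submodule.map_comap_subtype, Submodule.finrank_map_subtype_eq]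
  rfl

open Classical in
theorem finrank_sup_span_singleton_eq_add_ite {K V : Type*} [DivisionRing K] [AddCommGroup V]
    [Module K V] [Module.Finite K V] (p : Submodule K V) (x : V) :
    Module.finrank K ↥(p ⊔ K ∙ x) = Module.finrank K p + if x ∈ p then 0 else 1 := by
  split_ifs with hx
  · rw [sup_eq_left.2 ((Submodule.span_singleton_le_iff_mem x p).2 hx), add_zero]
  · exact Submodule.finrank_sup_span_singleton hx

end Rank

section Border

variable {V R : Type*} [DecidableEq V] [CommSemiring R]

/-- The matrix obtained from `A` by adding the vector `b` to the row and to the column of index `v`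
and `c` to the diagonal entry there. For `A` with zero row and column `v` and `b` with `b v = 0`,
this is the usual bordering of `A` by one row and one column, without a change of index type. -/
def border (A : Matrix V V R) (v : V) (b : V → R) (c : R) : Matrix V V R :=
  A + vecMulVec b (Pi.single v 1) + vecMulVec (Pi.single v 1) b +
    c • vecMulVec (Pi.single v 1) (Pi.single v 1)

theorem border_apply (A : Matrix V V R) (v : V) (b : V → R) (c : R) (i j : V) :
    border A v b c i j = A i j + (if j = v then b i else 0) + (if i = v then b j else 0) +
      if i = v ∧ j = v then c else 0 := by
  by_cases hi : i = v <;> by_cases hj : j = v <;> simp [border, vecMulVec_apply, hi, hj]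

theorem isSymm_border {A : Matrix V V R} (hA : A.IsSymm) (v : V) (b : V → R) (c : R) :
    (border A v b c).IsSymm := by
  refine IsSymm.ext fun i j => ?_
  simp only [border_apply, hA.apply i j, and_comm (a := j = v)]
  ring

variable [Fintype V]

theorem border_mulVec (A : Matrix V V R) (v : V) (b : V → R) (c : R) (y : V → R) :
    border A v b c *ᵥ y = A *ᵥ y + y v • b + (b ⬝ᵥ y + c * y v) • Pi.single v 1 := by
  ext i
  simp only [border, add_mulVec, vecMulVec_mulVec, single_dotProduct, one_mul, op_smul_eq_smul,
    smul_mulVec, Pi.add_apply, Pi.smul_apply, smul_eq_mul]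
  ring

end Border

section RankBorder

variable {V K : Type*} [Fintype V] [DecidableEq V] [Field K] {A : Matrix V V K} {v : V}

theorem border_mulVec_mulVec (hA : A.IsSymm) (x : V → K) (c : K) (y : V → K) :
    border A v (A *ᵥ x) c *ᵥ y =
      A *ᵥ (y + y v • x) + (x ⬝ᵥ A *ᵥ (y + y v • x)) • Pi.single v 1 +
        ((c - x ⬝ᵥ A *ᵥ x) * y v) • Pi.single v 1 := by
  rw [border_mulVec, mulVec_dotProduct_of_isSymm hA, mulVec_add, mulVec_smul,
    dotProduct_add, dotProduct_smul, smul_eq_mul]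
  module

theorem mulVec_single_one_eq_zero (hA : A.IsSymm) (hv : A.row v = 0) :
    A *ᵥ Pi.single v 1 = 0 := by
  rw [mulVec_single_one]
  exact (congrArg (·.row v) hA.eq).trans hv

theorem range_border_sup_span_single (hv : A *ᵥ Pi.single v 1 = 0) (b : V → K) (c : K) :
    (border A v b c).mulVecLin.range ⊔ K ∙ Pi.single v 1 =
      A.mulVecLin.range ⊔ K ∙ b ⊔ K ∙ Pi.single v 1 := by
  set e : V → K := Pi.single v 1 with he
  have he_mem (t : K) : t • e ∈ K ∙ e :=
    Submodule.smul_mem _ _ (Submodule.mem_span_singleton_self e)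
  refine le_antisymm (sup_le ?_ le_sup_right) (sup_le (sup_le ?_ ?_) le_sup_right)
  · rintro _ ⟨y, rfl⟩
    rw [mulVecLin_apply, border_mulVec]
    exact Submodule.add_mem_sup (Submodule.add_mem_sup ⟨y, rfl⟩
      (Submodule.smul_mem _ _ (Submodule.mem_span_singleton_self b))) (he_mem _)
  · rintro _ ⟨y, rfl⟩
    have hy : A *ᵥ y = border A v b c *ᵥ (y - y v • e) + (-(b ⬝ᵥ (y - y v • e))) • e := by
      rw [border_mulVec, mulVec_sub, mulVec_smul, hv]
      simp only [smul_zero, sub_zero, Pi.sub_apply, Pi.smul_apply, he, Pi.single_eq_same,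
        smul_eq_mul, mul_one, sub_self, zero_smul, mul_zero, add_zero]
      module
    rw [mulVecLin_apply, hy]
    exact Submodule.add_mem_sup ⟨_, rfl⟩ (he_mem _)
  · have hb : border A v b c *ᵥ e + (-(b ⬝ᵥ e + c)) • e = b := by
      rw [border_mulVec, hv]
      simp only [he, Pi.single_eq_same, one_smul, zero_add, mul_one]
      module
    have hmem := Submodule.add_mem_sup
      (LinearMap.mem_range_self (border A v b c).mulVecLin e) (he_mem (-(b ⬝ᵥ e + c)))
    rwa [mulVecLin_apply, hb, ← Submodule.span_singleton_le_iff_mem] at hmem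

theorem single_notMem_range_sup_span (hv : A.row v = 0) {b : V → K} (hb : b v = 0) :
    (Pi.single v 1 : V → K) ∉ A.mulVecLin.range ⊔ K ∙ b := by
  intro h
  obtain ⟨w, hw, _, hz, hwz⟩ := Submodule.mem_sup.1 h
  obtain ⟨t, rfl⟩ := Submodule.mem_span_singleton.1 hz
  simpa [apply_eq_zero_of_mem_range_mulVecLin hv hw, hb] using congrFun hwz v

open Classical in
theorem rank_border_add_ite (hA : A.IsSymm) (hv : A.row v = 0) {b : V → K} (hb : b v = 0) (c : K) :
    (border A v b c).rank + (if Pi.single v 1 ∈ (border A v b c).mulVecLin.range then 0 else 1) =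
      A.rank + (if b ∈ A.mulVecLin.range then 0 else 1) + 1 := by
  rw [Matrix.rank, Matrix.rank, ← finrank_sup_span_singleton_eq_add_ite,
    ← finrank_sup_span_singleton_eq_add_ite,
    range_border_sup_span_single (mulVec_single_one_eq_zero hA hv),
    Submodule.finrank_sup_span_singleton (single_notMem_range_sup_span hv hb)]

theorem single_mem_range_border_of_notMem (hA : A.IsSymm) (hv : A.row v = 0) {b : V → K}
    (hbv : b v = 0) (c : K) (hb : b ∉ A.mulVecLin.range) :
    Pi.single v 1 ∈ (border A v b c).mulVecLin.range := by
  obtain ⟨z, hAz, hbz⟩ := exists_mulVec_eq_zero_and_dotProduct_eq_one hA hb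
  refine ⟨z - z v • Pi.single v 1, ?_⟩
  rw [mulVecLin_apply, border_mulVec, mulVec_sub, mulVec_smul, hAz,
    mulVec_single_one_eq_zero hA hv, dotProduct_sub, dotProduct_smul, hbz]
  simp [hbv]

theorem single_mem_range_border_mulVec_iff (hA : A.IsSymm) (hv : A.row v = 0) (x : V → K) (c : K) :
    Pi.single v 1 ∈ (border A v (A *ᵥ x) c).mulVecLin.range ↔ c ≠ x ⬝ᵥ A *ᵥ x := by
  have hAe := mulVec_single_one_eq_zero hA hv
  refine ⟨?_, fun hc => ?_⟩
  · rintro ⟨y, hy⟩ rfl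
    rw [mulVecLin_apply, border_mulVec_mulVec hA, sub_self, zero_mul, zero_smul, add_zero] at hy
    set w := A *ᵥ (y + y v • x)
    have hwv : w v = 0 := apply_eq_zero_of_mem_range_mulVecLin hv ⟨_, rfl⟩
    have hxw : x ⬝ᵥ w = 1 := by simpa [hwv] using congrFun hy v
    have hw0 : w = 0 := by simpa [hxw] using hy
    simp [hw0] at hxw
  · -- `border_mulVec_mulVec` with `y` chosen so that `y v = 1` and `y + y v • x = (1 + x v) • e`
    set y : V → K := (1 + x v) • Pi.single v 1 - x with hy
    have hyv : y v = 1 := by simp [hy]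
    have hAy : A *ᵥ (y + y v • x) = 0 := by
      rw [hyv, one_smul, hy, sub_add_cancel, mulVec_smul, hAe, smul_zero]
    refine ⟨(c - x ⬝ᵥ A *ᵥ x)⁻¹ • y, ?_⟩
    rw [map_smul, mulVecLin_apply, border_mulVec_mulVec hA, hAy, hyv]
    simp [smul_smul, sub_ne_zero.2 hc]

theorem rank_border_of_notMem (hA : A.IsSymm) (hv : A.row v = 0) {b : V → K} (hbv : b v = 0)
    (c : K) (hb : b ∉ A.mulVecLin.range) : (border A v b c).rank = A.rank + 2 := by
  simpa [hb, single_mem_range_border_of_notMem hA hv hbv c hb] using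
    rank_border_add_ite hA hv hbv c

open Classical in
theorem rank_border_mulVec (hA : A.IsSymm) (hv : A.row v = 0) (x : V → K) (c : K) :
    (border A v (A *ᵥ x) c).rank = A.rank + if c = x ⬝ᵥ A *ᵥ x then 0 else 1 := by
  have hx : A *ᵥ x ∈ A.mulVecLin.range := ⟨x, rfl⟩
  have h := rank_border_add_ite hA hv (apply_eq_zero_of_mem_range_mulVecLin hv hx) c
  simp only [single_mem_range_border_mulVec_iff hA hv, hx, if_true] at h
  split_ifs at h ⊢ <;> simp_all

end RankBorder

section SumBorder

/-- The sum of `g (rank M)` over the matrices `M` bordering a fixed symmetric matrix of rank `r`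
over a field with `q` elements, if the bordering vector runs through a space of dimension `m` that
meets the range of the matrix in dimension `k`. -/
def borderWeight {R : Type*} [CommRing R] (q : R) (m k : ℕ) (g : ℕ → R) (r : ℕ) : R :=
  q ^ k * (g r + (q - 1) * g (r + 1)) + (q ^ m - q ^ k) * (q * g (r + 2))

theorem map_borderWeight {R S : Type*} [CommRing R] [CommRing S] (f : R →+* S) (q : R) (m k : ℕ)
    (g : ℕ → R) (r : ℕ) :
    f (borderWeight q m k g r) = borderWeight (f q) m k (fun i => f (g i)) r := by
  simp [borderWeight]

open Classical in
theorem sum_ite_mem_submodule {K E R : Type*} [DivisionRing K] [AddCommGroup E] [Module K E]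
    [Finite E] [CommRing R] (B W : Submodule K E) [Fintype B] (x y : R) :
    ∑ b : B, (if (b : E) ∈ W then x else y) =
      (Nat.card K : R) ^ Module.finrank K ↥(B ⊓ W) * x +
        ((Nat.card K : R) ^ Module.finrank K B - (Nat.card K : R) ^ Module.finrank K ↥(B ⊓ W)) *
          y := by
  have hB : (Finset.univ : Finset B).card = Nat.card K ^ Module.finrank K B := by
    rw [Finset.card_univ, ← Nat.card_eq_fintype_card, Module.natCard_eq_pow_finrank (K := K)]
  have hBW : (Finset.univ.filter fun b : B => (b : E) ∈ W).card =
      Nat.card K ^ Module.finrank K ↥(B ⊓ W) := by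
    rw [← Fintype.card_subtype, ← Nat.card_eq_fintype_card, ← Module.natCard_eq_pow_finrank]
    exact Nat.card_congr (Equiv.subtypeSubtypeEquivSubtypeInter (· ∈ B) (· ∈ W))
  have hadd := Finset.card_filter_add_card_filter_not (s := Finset.univ) fun b : B => (b : E) ∈ W
  rw [Finset.sum_ite, Finset.sum_const, Finset.sum_const, nsmul_eq_mul, nsmul_eq_mul,
    ← Nat.cast_pow, ← Nat.cast_pow, ← hB, ← hBW, ← hadd]
  push_cast
  ring

variable {V K R : Type*} [Fintype V] [DecidableEq V] [Field K] [Fintype K] [CommRing R]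
  {A : Matrix V V K} {v : V}

theorem sum_rank_border_of_mem (hA : A.IsSymm) (hv : A.row v = 0) {b : V → K}
    (hb : b ∈ A.mulVecLin.range) (g : ℕ → R) :
    ∑ c, g (border A v b c).rank = g A.rank + (Nat.card K - 1) * g (A.rank + 1) := by
  classical
  obtain ⟨x, rfl⟩ := hb
  have hne (c : K) (hc : c ∈ Finset.univ.erase (x ⬝ᵥ A *ᵥ x)) :
      g (border A v (A *ᵥ x) c).rank = g (A.rank + 1) := by
    rw [rank_border_mulVec hA hv, if_neg (Finset.ne_of_mem_erase hc)]
  rw [← Finset.add_sum_erase _ _ (Finset.mem_univ (x ⬝ᵥ A *ᵥ x)), mulVecLin_apply,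
    Finset.sum_congr rfl hne, rank_border_mulVec hA hv]
  simp [Finset.card_erase_of_mem, Nat.cast_sub Fintype.card_pos]

theorem sum_rank_border_of_notMem (hA : A.IsSymm) (hv : A.row v = 0) {b : V → K} (hbv : b v = 0)
    (hb : b ∉ A.mulVecLin.range) (g : ℕ → R) :
    ∑ c, g (border A v b c).rank = Nat.card K * g (A.rank + 2) := by
  simp [rank_border_of_notMem hA hv hbv _ hb]

theorem sum_sum_rank_border (hA : A.IsSymm) (hv : A.row v = 0) {B : Submodule K (V → K)} [Fintype B]
    (hB : ∀ b ∈ B, b v = 0) (g : ℕ → R) :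
    ∑ b : B, ∑ c, g (border A v b c).rank =
      borderWeight (Nat.card K : R) (Module.finrank K B)
        (Module.finrank K ↥(B ⊓ A.mulVecLin.range)) g A.rank := by
  classical
  rw [borderWeight, ← sum_ite_mem_submodule]
  refine Finset.sum_congr rfl fun b _ => ?_
  split_ifs with hb
  · exact sum_rank_border_of_mem hA hv hb g
  · exact sum_rank_border_of_notMem hA hv (hB b b.2) hb g

end SumBorder

section GraphMatrices

variable {V R : Type*} [CommSemiring R] {G : SimpleGraph V} {S : Set V}

/-- The space of symmetric matrices supported on `S × S` that vanish on the edges of `G`. For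
`S = Set.univ` the invertible ones among them are the `R`-points of `Z_G`. Matrices attached to the
induced subgraph on `S` are thus extended by zero, which does not change their rank. -/
def graphMatrices (R : Type*) [CommSemiring R] (G : SimpleGraph V) (S : Set V) :
    Submodule R (Matrix V V R) where
  carrier := {M | M.IsSymm ∧ (∀ i ∉ S, M.row i = 0) ∧ ∀ i j, G.Adj i j → M i j = 0}
  zero_mem' := ⟨isSymm_zero, fun _ _ => rfl, fun _ _ _ => rfl⟩
  add_mem' hM hN := ⟨hM.1.add hN.1,
    fun i hi => (congrArg₂ (· + ·) (hM.2.1 i hi) (hN.2.1 i hi)).trans (add_zero 0),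
    fun i j hij => by simp [hM.2.2 i j hij, hN.2.2 i j hij]⟩
  smul_mem' c M hM := ⟨hM.1.smul c,
    fun i hi => (congrArg (c • ·) (hM.2.1 i hi)).trans (smul_zero c),
    fun i j hij => by simp [hM.2.2 i j hij]⟩

theorem mem_graphMatrices {M : Matrix V V R} : M ∈ graphMatrices R G S ↔
    M.IsSymm ∧ (∀ i ∉ S, M.row i = 0) ∧ ∀ i j, G.Adj i j → M i j = 0 :=
  Iff.rfl

theorem graphMatrices_empty : graphMatrices R G ∅ = ⊥ :=
  (Submodule.eq_bot_iff _).2 fun _ hM => funext fun i => hM.2.1 i (Set.notMem_empty i)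

theorem mem_graphMatrices_diff_singleton {u : V} {M : Matrix V V R} :
    M ∈ graphMatrices R G (S \ {u}) ↔ M ∈ graphMatrices R G S ∧ M.row u = 0 := by
  simp only [mem_graphMatrices, Set.mem_sdiff, Set.mem_singleton_iff, not_and_or, not_not]
  grind

theorem map_mem_graphMatrices {R' : Type*} [CommSemiring R'] (f : R →+* R') {M : Matrix V V R}
    (hM : M ∈ graphMatrices R G S) : M.map f ∈ graphMatrices R' G S := by
  refine ⟨hM.1.map f, fun i hi => funext fun j => ?_, fun i j hij => ?_⟩
  · simpa using congrArg f (congrFun (hM.2.1 i hi) j)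
  · rw [map_apply, hM.2.2 i j hij, map_zero]

variable [DecidableEq V] {v : V}

/-- The matrix `M` with the entries of row and column `v` replaced by zero. -/
def zeroCross (M : Matrix V V R) (v : V) : Matrix V V R :=
  Matrix.of fun i j => if i = v ∨ j = v then 0 else M i j

theorem zeroCross_mem_graphMatrices {M : Matrix V V R} (hM : M ∈ graphMatrices R G S) (v : V) :
    zeroCross M v ∈ graphMatrices R G (S \ {v}) := by
  obtain ⟨hs, hS, hG⟩ := hM
  refine mem_graphMatrices_diff_singleton.2 ⟨⟨?_, fun i hi => ?_, fun i j hij => ?_⟩, ?_⟩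
  · exact IsSymm.ext fun i j => by simp [zeroCross, or_comm, hs.apply i j]
  · ext j
    simpa [zeroCross] using fun _ _ => congrFun (hS i hi) j
  · simp [zeroCross, hG i j hij]
  · ext j
    simp [zeroCross]

theorem update_row_mem_coordSubspace {M : Matrix V V R} (hM : M ∈ graphMatrices R G S) (v : V) :
    Function.update (M.row v) v 0 ∈ coordSubspace R ((S \ {v}) \ G.neighborSet v) := by
  obtain ⟨hs, hS, hG⟩ := hM
  refine mem_coordSubspace.2 fun i hi => ?_
  rcases eq_or_ne i v with rfl | hiv
  · simp
  · rw [Function.update_of_ne hiv, row_apply]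
    by_cases hiS : i ∈ S
    · exact hG v i (by simpa [hiS, hiv] using hi)
    · rw [← hs.apply]
      exact congrFun (hS i hiS) v

theorem border_mem_graphMatrices (hv : v ∈ S) {A : Matrix V V R}
    (hA : A ∈ graphMatrices R G (S \ {v})) {b : V → R}
    (hb : b ∈ coordSubspace R ((S \ {v}) \ G.neighborSet v)) (c : R) :
    border A v b c ∈ graphMatrices R G S := by
  rw [mem_coordSubspace] at hb
  obtain ⟨⟨hs, hS, hG⟩, -⟩ := mem_graphMatrices_diff_singleton.1 hA
  refine ⟨isSymm_border hs v b c, fun i hi => funext fun j => ?_, fun i j hij => ?_⟩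
  · have hiv : i ≠ v := fun h => hi (h ▸ hv)
    have hij : A i j = 0 := congrFun (hS i hi) j
    simp [border_apply, hiv, hij, hb i fun h => hi h.1.1]
  · rw [border_apply, hG i j hij]
    have := hij.ne
    split_ifs <;> simp_all [G.adj_comm]

/-- Cutting off row and column `v`, as an inverse of bordering. -/
def borderEquiv (R : Type*) [CommSemiring R] (G : SimpleGraph V) (hv : v ∈ S) :
    graphMatrices R G (S \ {v}) × coordSubspace R ((S \ {v}) \ G.neighborSet v) × R ≃
      graphMatrices R G S where
  toFun p := ⟨border p.1 v p.2.1 p.2.2, border_mem_graphMatrices hv p.1.2 p.2.1.2 p.2.2⟩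
  invFun M := (⟨zeroCross M.1 v, zeroCross_mem_graphMatrices M.2 v⟩,
    ⟨Function.update (M.1.row v) v 0, update_row_mem_coordSubspace M.2 v⟩, M.1 v v)
  left_inv := by
    rintro ⟨⟨A, hA⟩, ⟨b, hb⟩, c⟩
    have hbv : b v = 0 := mem_coordSubspace.1 hb v (by simp)
    have hrow (j : V) : A v j = 0 := congrFun (hA.2.1 v (by simp)) j
    have hcol (j : V) : A j v = 0 := by rw [← hA.1.apply, hrow]
    simp only [Prod.mk.injEq, Subtype.mk.injEq]
    refine ⟨?_, ?_, ?_⟩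
    · ext i j
      by_cases hi : i = v <;> by_cases hj : j = v <;> simp [zeroCross, border_apply, *]
    · ext i
      by_cases hi : i = v <;> simp [border_apply, *]
    · simp [border_apply, *]
  right_inv := by
    rintro ⟨M, hM⟩
    ext i j
    by_cases hi : i = v <;> by_cases hj : j = v <;>
      simp [zeroCross, border_apply, *, hM.1.apply]

end GraphMatrices

section RankSum

variable {V K R : Type*} [Fintype V] [Field K] {G : SimpleGraph V} {S : Set V} {u v : V}

theorem finrank_coordSubspace_inf_range_of_inter_neighborSet_eq_empty
    {A : Matrix V V K} (hA : A ∈ graphMatrices K G S) (hv : S ∩ G.neighborSet v = ∅) :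
    Module.finrank K ↥(coordSubspace K (S \ G.neighborSet v) ⊓ A.mulVecLin.range) = A.rank := by
  rw [← Set.disjoint_iff_inter_eq_empty] at hv
  rw [hv.sdiff_eq_left, inf_eq_right.2 fun b hb => mem_coordSubspace.2 fun i hi =>
    apply_eq_zero_of_mem_range_mulVecLin (hA.2.1 i hi) hb, Matrix.rank]

theorem coordSubspace_inf_range_eq_ker_proj {A : Matrix V V K} (hA : A ∈ graphMatrices K G S)
    (hv : S ∩ G.neighborSet v = {u}) :
    coordSubspace K (S \ G.neighborSet v) ⊓ A.mulVecLin.range =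
      A.mulVecLin.range ⊓ LinearMap.ker (LinearMap.proj u) := by
  ext b
  rw [Submodule.mem_inf, Submodule.mem_inf, and_comm, mem_coordSubspace, LinearMap.mem_ker,
    LinearMap.proj_apply]
  refine and_congr_right fun hb => ⟨fun h => h u fun hu => ?_, fun h i hi => ?_⟩
  · exact hu.2 (hv.ge rfl).2
  · by_cases hiS : i ∈ S
    · obtain rfl : i = u := hv.le ⟨hiS, by simpa [hiS] using hi⟩
      exact h
    · exact apply_eq_zero_of_mem_range_mulVecLin (hA.2.1 i hiS) hb

open Classical in
theorem finrank_coordSubspace_inf_range_of_inter_neighborSet_eq_singleton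
    {A : Matrix V V K} (hA : A ∈ graphMatrices K G S) (hv : S ∩ G.neighborSet v = {u}) :
    Module.finrank K ↥(coordSubspace K (S \ G.neighborSet v) ⊓ A.mulVecLin.range) =
      if A.row u = 0 then A.rank else A.rank - 1 := by
  rw [coordSubspace_inf_range_eq_ker_proj hA hv]
  split_ifs with hu
  · rw [inf_eq_left.2 fun b => apply_eq_zero_of_mem_range_mulVecLin hu, Matrix.rank]
  · exact finrank_range_mulVecLin_inf_ker_proj hu

variable [Fintype K] [CommRing R]

open Classical in
theorem sum_graphMatrices_diff_singleton (u : V) (f : Matrix V V K → R) :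
    ∑ A : graphMatrices K G (S \ {u}), f A =
      ∑ A : graphMatrices K G S, if A.1.row u = 0 then f A else 0 := by
  rw [← Finset.sum_subtype (Finset.univ.filter (· ∈ graphMatrices K G (S \ {u}))) (by simp) f,
    ← Finset.sum_subtype (Finset.univ.filter (· ∈ graphMatrices K G S)) (by simp)
      fun A => if A.row u = 0 then f A else 0,
    ← Finset.sum_filter, Finset.filter_filter]
  simp only [mem_graphMatrices_diff_singleton]

open Classical in
/-- The sum of `g (rank M)` over the matrices `M` in `graphMatrices K G S`. Keeping the weight `g`
arbitrary makes the recursion over `S` close up; invertible matrices are counted by the indicator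
of maximal rank. -/
noncomputable def rankSum (K : Type*) [Field K] [Fintype K] (G : SimpleGraph V) (S : Set V)
    (g : ℕ → R) : R :=
  ∑ M : graphMatrices K G S, g M.1.rank

theorem rankSum_empty (g : ℕ → R) : rankSum K G ∅ g = g 0 := by
  classical
  have h (M : graphMatrices K G ∅) : g M.1.rank = g 0 := by
    rw [(Submodule.mem_bot K).1 (graphMatrices_empty.le M.2), rank_zero]
  have : Unique (graphMatrices K G ∅) := graphMatrices_empty (G := G) (R := K) ▸ inferInstance
  simp [rankSum, h]

open Classical in
theorem rankSum_eq_sum_borderWeight (hv : v ∈ S) (g : ℕ → R) :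
    rankSum K G S g = ∑ A : graphMatrices K G (S \ {v}),
      borderWeight (Nat.card K : R) ((S \ {v}) \ G.neighborSet v).ncard
        (Module.finrank K
          ↥(coordSubspace K ((S \ {v}) \ G.neighborSet v) ⊓ A.1.mulVecLin.range)) g A.1.rank := by
  rw [rankSum, ← (borderEquiv K G hv).sum_comp, Fintype.sum_prod_type]
  refine Finset.sum_congr rfl fun A _ => ?_
  rw [Fintype.sum_prod_type, ← finrank_coordSubspace (R := K)]
  exact sum_sum_rank_border A.2.1 (A.2.2.1 v (by simp))
    (fun b hb => mem_coordSubspace.1 hb v (by simp)) g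

theorem rankSum_of_inter_neighborSet_eq_empty (hv : v ∈ S) (hvS : S \ {v} ∩ G.neighborSet v = ∅)
    (g : ℕ → R) :
    rankSum K G S g = rankSum K G (S \ {v}) fun r =>
      borderWeight (Nat.card K : R) ((S \ {v}) \ G.neighborSet v).ncard r g r := by
  classical
  rw [rankSum_eq_sum_borderWeight hv, rankSum]
  exact Finset.sum_congr rfl fun A _ => by
    rw [finrank_coordSubspace_inf_range_of_inter_neighborSet_eq_empty A.2 hvS]

/-- The first sum treats row `u` as nonzero throughout. The second one corrects the terms in which
it vanishes, among them the term `r = 0`, where `r - 1` is truncated. -/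
theorem rankSum_of_inter_neighborSet_eq_singleton (hv : v ∈ S)
    (hvS : S \ {v} ∩ G.neighborSet v = {u}) (g : ℕ → R) :
    let w (k r : ℕ) : R :=
      borderWeight (Nat.card K : R) ((S \ {v}) \ G.neighborSet v).ncard k g r
    rankSum K G S g = rankSum K G (S \ {v}) (fun r => w (r - 1) r) +
      rankSum K G ((S \ {v}) \ {u}) (fun r => w r r - w (r - 1) r) := by
  classical
  intro w
  rw [rankSum_eq_sum_borderWeight hv, rankSum, rankSum,
    sum_graphMatrices_diff_singleton u fun A => w A.rank A.rank - w (A.rank - 1) A.rank,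
    ← Finset.sum_add_distrib]
  refine Finset.sum_congr rfl fun A _ => ?_
  rw [finrank_coordSubspace_inf_range_of_inter_neighborSet_eq_singleton A.2 hvS]
  split_ifs <;> ring

end RankSum

section Forest

variable {V : Type*} {G : SimpleGraph V}

theorem exists_neighborSet_subsingleton_of_isAcyclic [Nonempty V] [Finite G.edgeSet]
    (hG : G.IsAcyclic) : ∃ v, (G.neighborSet v).Subsingleton := by
  obtain ⟨v, _, p, hp, hmax⟩ := SimpleGraph.Walk.exists_isPath_forall_isPath_length_le_length G
  suffices h : ∀ w, G.Adj v w → w = p.snd from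
    ⟨v, fun w hw w' hw' => (h w hw).trans (h w' hw').symm⟩
  intro w hw
  refine hG.eq_snd_of_adj_start hp hw (by_contra fun hwp => ?_)
  have := hmax _ _ _ (hp.cons hwp (h := hw.symm))
  simp at this

theorem exists_inter_neighborSet_subsingleton_of_isAcyclic [Finite V] (hG : G.IsAcyclic)
    {S : Set V} (hS : S.Nonempty) : ∃ v ∈ S, (S ∩ G.neighborSet v).Subsingleton := by
  have := hS.to_subtype
  obtain ⟨v, hv⟩ := exists_neighborSet_subsingleton_of_isAcyclic (hG.induce S)
  exact ⟨v, v.2, fun w hw w' hw' =>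
    congrArg Subtype.val (hv (x := ⟨w, hw.1⟩) hw.2 (y := ⟨w', hw'.1⟩) hw'.2)⟩

theorem exists_polynomial_rankSum_eq_eval [Fintype V] (hG : G.IsAcyclic) (S : Set V)
    (g : ℕ → ℤ[X]) :
    ∃ P : ℤ[X], ∀ (K : Type*) [Field K] [Fintype K],
      rankSum K G S (fun r => (g r).eval (Nat.card K : ℤ)) = P.eval (Nat.card K : ℤ) := by
  induction S using WellFoundedLT.induction generalizing g with
  | ind S ih =>
  rcases S.eq_empty_or_nonempty with rfl | hS
  · exact ⟨g 0, fun K _ _ => rankSum_empty _⟩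
  obtain ⟨v, hv, hvS⟩ := exists_inter_neighborSet_subsingleton_of_isAcyclic hG hS
  have hlt : S \ {v} < S := Set.sdiff_singleton_ssubset.2 hv
  let w (k r : ℕ) : ℤ[X] := borderWeight X ((S \ {v}) \ G.neighborSet v).ncard k g r
  have eval_w (q : ℤ) (k r : ℕ) : (w k r).eval q =
      borderWeight q ((S \ {v}) \ G.neighborSet v).ncard k (fun i => (g i).eval q) r := by
    simpa using map_borderWeight (evalRingHom q) X ((S \ {v}) \ G.neighborSet v).ncard k g r
  have hvS' : (S \ {v} ∩ G.neighborSet v).Subsingleton :=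
    hvS.anti (Set.inter_subset_inter_left _ Set.sdiff_subset)
  rcases hvS'.eq_empty_or_singleton with h | ⟨u, h⟩
  · obtain ⟨P, hP⟩ := ih _ hlt fun r => w r r
    exact ⟨P, fun K _ _ => by
      rw [← hP, rankSum_of_inter_neighborSet_eq_empty hv h]
      simp only [eval_w]⟩
  · obtain ⟨P, hP⟩ := ih _ hlt fun r => w (r - 1) r
    obtain ⟨Q, hQ⟩ := ih ((S \ {v}) \ {u}) (Set.sdiff_subset.trans_lt hlt)
      fun r => w r r - w (r - 1) r
    exact ⟨P + Q, fun K _ _ => by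
      rw [eval_add, ← hP, ← hQ, rankSum_of_inter_neighborSet_eq_singleton hv h]
      simp only [eval_w, eval_sub]⟩

end Forest

section Points

theorem zIdeal_le_ker_eval₂Hom {V : Type u} {G : SimpleGraph V} {R : Type*} [CommRing R]
    {M : Matrix V V R} (hM : M ∈ graphMatrices R G Set.univ) :
    zIdeal G ≤ RingHom.ker
      (MvPolynomial.eval₂Hom (Int.castRingHom R) fun p : V × V => M p.1 p.2) := by
  refine Ideal.span_le.2 ?_
  rintro _ (⟨i, j, rfl⟩ | ⟨i, j, hij, rfl⟩)
  · simp [RingHom.mem_ker, hM.1.apply]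
  · simp [RingHom.mem_ker, hM.2.2 i j hij]

variable {V : Type u} [Fintype V] [DecidableEq V] {G : SimpleGraph V} {R : Type*} [CommRing R]

/-- The matrix of coordinate functions on `Z_G`, that is, its tautological point with values in its
coordinate ring. -/
noncomputable def universalMatrix (G : SimpleGraph V) : Matrix V V (ZRing G) :=
  Matrix.of fun i j =>
    algebraMap _ (ZRing G) (Ideal.Quotient.mk (zIdeal G) (MvPolynomial.X (i, j)))

theorem universalMatrix_mem_graphMatrices :
    universalMatrix G ∈ graphMatrices (ZRing G) G Set.univ := by
  refine ⟨IsSymm.ext fun i j => ?_, by simp, fun i j hij => ?_⟩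
  · have h : Ideal.Quotient.mk (zIdeal G) (MvPolynomial.X (j, i)) =
        Ideal.Quotient.mk (zIdeal G) (MvPolynomial.X (i, j)) :=
      Ideal.Quotient.eq.2 (Ideal.subset_span (.inl ⟨j, i, rfl⟩))
    rw [universalMatrix, of_apply, of_apply, h]
  · have h : Ideal.Quotient.mk (zIdeal G) (MvPolynomial.X (i, j)) = 0 :=
      Ideal.Quotient.eq_zero_iff_mem.2 (Ideal.subset_span (.inr ⟨i, j, hij, rfl⟩))
    rw [universalMatrix, of_apply, h, map_zero]

theorem map_genericDet (f : MvPolynomial (V × V) ℤ →+* R) :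
    f (genericDet V) = (Matrix.of fun i j => f (MvPolynomial.X (i, j))).det := by
  rw [genericDet, RingHom.map_det]
  rfl

theorem isUnit_det_universalMatrix : IsUnit (universalMatrix G).det := by
  have h := map_genericDet ((algebraMap _ (ZRing G)).comp (Ideal.Quotient.mk (zIdeal G)))
  exact (congrArg IsUnit h).mp <|
    IsLocalization.Away.algebraMap_isUnit (Ideal.Quotient.mk (zIdeal G) (genericDet V))

theorem ringHom_ext_of_map_universalMatrix {φ ψ : ZRing G →+* R}
    (h : (universalMatrix G).map φ = (universalMatrix G).map ψ) : φ = ψ :=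
  IsLocalization.ringHom_ext (.powers (Ideal.Quotient.mk (zIdeal G) (genericDet V))) <|
    Ideal.Quotient.ringHom_ext <| MvPolynomial.ringHom_ext' (RingHom.ext_int _ _) fun p =>
      congrFun (congrFun h p.1) p.2

theorem exists_map_universalMatrix_eq {M : Matrix V V R} (hM : M ∈ graphMatrices R G Set.univ)
    (hdet : IsUnit M.det) : ∃ φ : ZRing G →+* R, (universalMatrix G).map φ = M := by
  obtain ⟨f, hf⟩ : ∃ f : MvPolynomial (V × V) ℤ ⧸ zIdeal G →+* R,
      ∀ i j, f (Ideal.Quotient.mk (zIdeal G) (MvPolynomial.X (i, j))) = M i j :=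
    ⟨Ideal.Quotient.lift (zIdeal G) _ (zIdeal_le_ker_eval₂Hom hM), fun _ _ =>
      (Ideal.Quotient.lift_mk _ _ _).trans (MvPolynomial.eval₂_X _ _ _)⟩
  have hfdet : f (Ideal.Quotient.mk (zIdeal G) (genericDet V)) = M.det :=
    (map_genericDet (f.comp (Ideal.Quotient.mk (zIdeal G)))).trans
      (congrArg Matrix.det (Matrix.ext hf))
  refine ⟨IsLocalization.Away.lift _ (hfdet ▸ hdet), ?_⟩
  ext i j
  rw [map_apply, universalMatrix, of_apply, IsLocalization.Away.lift_eq, hf]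

/-- The universal property of `ZRing G`: a homomorphism to `R` is determined by the image of
`universalMatrix G`, which can be any nondegenerate matrix in `graphMatrices R G Set.univ`. -/
noncomputable def zRingHomEquiv (G : SimpleGraph V) (R : Type*) [CommRing R] :
    (ZRing G →+* R) ≃ {M : graphMatrices R G Set.univ // IsUnit M.1.det} :=
  .ofBijective
    (fun φ => ⟨⟨(universalMatrix G).map φ,
      map_mem_graphMatrices φ universalMatrix_mem_graphMatrices⟩, by
        simpa only [RingHom.map_det, RingHom.mapMatrix_apply] using
          isUnit_det_universalMatrix.map φ⟩)
    ⟨fun _ _ h => ringHom_ext_of_map_universalMatrix (congrArg (fun M => M.1.1) h),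
      fun M => by
        obtain ⟨φ, hφ⟩ := exists_map_universalMatrix_eq M.1.2 M.2
        exact ⟨φ, Subtype.ext (Subtype.ext hφ)⟩⟩

/-- The `R`-points of `Z_G`, as nondegenerate matrices over `R`. -/
noncomputable def zSchemePointsEquiv (G : SimpleGraph V) (R : Type u) [CommRing R] :
    (Spec (CommRingCat.of R) ⟶ ZScheme G) ≃
      {M : graphMatrices R G Set.univ // IsUnit M.1.det} :=
  (Spec.homEquiv.trans ⟨CommRingCat.Hom.hom, CommRingCat.ofHom, fun _ => rfl, fun _ => rfl⟩).trans
    (zRingHomEquiv G R)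

theorem natCard_zScheme_points (G : SimpleGraph V) (K : Type u) [Field K] [Fintype K] :
    (Nat.card (Spec (CommRingCat.of K) ⟶ ZScheme G) : ℤ) =
      rankSum K G Set.univ fun r => if r = Fintype.card V then 1 else 0 := by
  classical
  rw [Nat.card_congr (zSchemePointsEquiv G K), rankSum]
  simp only [rank_eq_card_iff_isUnit_det, Finset.sum_boole, ← Fintype.card_subtype]
  simp only [← Nat.card_eq_fintype_card]

end Points

theorem mainTheorem8 {V : Type u} [Fintype V] [DecidableEq V] (F : SimpleGraph V)
    (hF : F.IsAcyclic) : PolynomiallyCountable (ZScheme F) := by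
  obtain ⟨P, hP⟩ := exists_polynomial_rankSum_eq_eval hF Set.univ
    fun r => if r = Fintype.card V then 1 else 0
  refine ⟨P, fun K _ _ => ⟨.of_equiv _ (zSchemePointsEquiv F K).symm, ?_⟩⟩
  have := Fintype.ofFinite K
  rw [natCard_zScheme_points, ← hP]
  simp only [apply_ite (eval _), eval_one, eval_zero]
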